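/- Let $K$ be a field and $q\in K$ with $q\neq 1$ (for instance $K=\mathbb{Q}(q)$ with $q$ an indeterminate, or $q$ a real or complex number). Put $[m]_q=\frac{1-q^m}{1-q}$, and define the $q$-secant numbers $E_{2n}(q)\in K$, $n\ge 0$, by the identity of formal power series in $x$ $$\sum_{n=0}^{\infty} E_{2n}(q)\,x^n=\cfrac{1}{1-\cfrac{[1]_q^2\,x}{1-\cfrac{[2]_q^2\,x}{1-\cfrac{[3]_q^2\,x}{\ddots}}}},$$ where the infinite continued fraction is the formal limit (coefficient by coefficient) of its finite truncations. Then for every integer $n\ge 0$ $$E_{2n}(q)=\frac{1}{(1-q)^{2n}}\sum_{k=0}^{n}\left(\binom{2n}{n-k}-\binom{2n}{n-k-1}\right)\sum_{i=0}^{2k}(-1)^{i+k}\,q^{\,i(2k-i)+k},$$ where $\binom{2n}{-1}=0$ and $q^0=1$ (also when $q=0$). -/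

import Mathlib

/-- The `m`-th truncation, as a formal power series in `X` over the field `K`, of the continued
fraction `1 / (1 - c 0 * X / (1 - c 1 * X / (1 - c 2 * X / ...)))`: it involves `c 0, ..., c (m-1)`.
Every denominator has constant term `1`, so that the inverses are genuine inverses. -/
noncomputable def cfTrunc {K : Type*} [Field K] (c : ℕ → K) : ℕ → PowerSeries K
  | 0 => 1
  | m + 1 => (1 - PowerSeries.C (c 0) * PowerSeries.X * cfTrunc (fun j => c (j + 1)) m)⁻¹

theorem X_pow_dvd_cfTrunc_sub {K : Type*} [Field K] (n : ℕ) :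
    ∀ (c : ℕ → K) (m : ℕ), n ≤ m →
      (PowerSeries.X : PowerSeries K) ^ (n + 1) ∣ cfTrunc c m - cfTrunc c n := by
  induction n with
  | zero =>
    intro c m _
    rw [zero_add, pow_one, PowerSeries.X_dvd_iff]
    cases m <;> simp [cfTrunc]
  | succ n ih =>
    intro c m hm
    obtain ⟨m, rfl⟩ : ∃ m', m = m' + 1 := ⟨m - 1, by omega⟩
    obtain ⟨r, hr⟩ := ih (fun j => c (j + 1)) m (by omega)
    simp only [cfTrunc]
    set a := cfTrunc (fun j => c (j + 1)) m
    set b := cfTrunc (fun j => c (j + 1)) n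
    have hA := PowerSeries.mul_inv_cancel
      (1 - PowerSeries.C (c 0) * PowerSeries.X * a) (by simp)
    have hB := PowerSeries.mul_inv_cancel
      (1 - PowerSeries.C (c 0) * PowerSeries.X * b) (by simp)
    set A := (1 - PowerSeries.C (c 0) * PowerSeries.X * a)⁻¹
    set B := (1 - PowerSeries.C (c 0) * PowerSeries.X * b)⁻¹
    refine ⟨PowerSeries.C (c 0) * r * A * B, ?_⟩
    linear_combination B * hA - A * hB + (PowerSeries.C (c 0) * PowerSeries.X * A * B) * hr

/-- The formal power series defined by the infinite continued fraction
`1 / (1 - c 0 * X / (1 - c 1 * X / (1 - c 2 * X / ...)))`, that is, the limit of its truncations: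
each coefficient is the eventual value of that coefficient in the truncations
(see `coeff_cfTrunc_eq`). -/
noncomputable def cfSeries {K : Type*} [Field K] (c : ℕ → K) : PowerSeries K :=
  PowerSeries.mk fun n => PowerSeries.coeff n (cfTrunc c n)

theorem coeff_cfTrunc_eq {K : Type*} [Field K] (c : ℕ → K) (n m : ℕ) (h : n ≤ m) :
    PowerSeries.coeff n (cfTrunc c m) = PowerSeries.coeff n (cfSeries c) := by
  have := PowerSeries.X_pow_dvd_iff.1 (X_pow_dvd_cfTrunc_sub n c m h) n (Nat.lt_succ_self n)
  rw [map_sub, sub_eq_zero] at this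
  rw [this, cfSeries, PowerSeries.coeff_mk]

/-- The `q`-integer `[n]_q = (1 - q ^ n) / (1 - q)`, used for `q ≠ 1`. -/
noncomputable def qInt {K : Type*} [Field K] (q : K) (n : ℕ) : K := (1 - q ^ n) / (1 - q)

/-- `qSecant q n` is the `q`-secant number `E_{2n}(q)`: the coefficient of `X ^ n` in
`1 / (1 - [1]_q ^ 2 * X / (1 - [2]_q ^ 2 * X / (1 - [3]_q ^ 2 * X / ...)))`. -/
noncomputable def qSecant {K : Type*} [Field K] (q : K) (n : ℕ) : K :=
  PowerSeries.coeff n (cfSeries fun j => qInt q (j + 1) ^ 2)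

/-- The binomial coefficient with an integer lower index, equal to `0` if this index is negative. -/
def binom (n : ℕ) (k : ℤ) : ℕ := if 0 ≤ k then n.choose k.toNat else 0

/-! Up to the factor `(1 - q) ^ (2 * n)`, the secant number is a moment for the weights `(1 - q ^ (j
+ 1)) ^ 2`, so it suffices to find a functional that sends 1 to 1 and kills every `secantPoly` of
positive degree in `y = t + t⁻¹`. Let `Λ` send `t ^ (2k+1)` to `intThetaSum q k` and even powers to
0; the functional is `f ↦ Λ(t f)`. The recurrence of the theta sums says `Λ(t f(t)) - Λ(t⁻¹ f(q t))
= f(s) + f(-s)` with `s² = -q`. By `sub_mul_secantPoly`, `(t - t⁻¹) p` has the form `t f(t) - t⁻¹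
f(q t)` with `t + q t⁻¹` dividing `f`, so `Λ((t - t⁻¹) p) = 0`. As `Λ` is odd and `p` is even under
`t ↦ t⁻¹`, this reads `2 Λ(t p) = 0`. Expanding `Λ(t (t + t⁻¹) ^ (2n))` gives the formula. -/

/-! ### Moments of a Stieltjes continued fraction -/

/-- The array of moments attached to the Stieltjes continued fraction with coefficients `c`: the
entry at `(n, h)` is the total weight of the paths of length `h + 2 * n` from height `h` to `0`,
where a step down from height `j + 1` has weight `c j`. -/
def stieltjesMoment {R : Type*} [CommRing R] (c : ℕ → R) : ℕ → ℕ → R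
  | 0, 0 => 1
  | 0, h + 1 => c h * stieltjesMoment c 0 h
  | n + 1, 0 => stieltjesMoment c n 1
  | n + 1, h + 1 => c h * stieltjesMoment c (n + 1) h + stieltjesMoment c n (h + 2)

theorem map_stieltjesMoment {R S : Type*} [CommRing R] [CommRing S] (f : R →+* S) (c : ℕ → R)
    (n h : ℕ) : f (stieltjesMoment c n h) = stieltjesMoment (fun j => f (c j)) n h := by
  induction n generalizing h with
  | zero => induction h with
    | zero => simp [stieltjesMoment]
    | succ h ih => simp [stieltjesMoment, ih]
  | succ n ihn => induction h with
    | zero => simp [stieltjesMoment, ihn]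
    | succ h ih => simp [stieltjesMoment, ih, ihn]

theorem cfSeries_mul_eq_one {K : Type*} [Field K] (c : ℕ → K) :
    cfSeries c *
      (1 - PowerSeries.C (c 0) * PowerSeries.X * cfSeries (fun j => c (j + 1))) = 1 := by
  ext n
  have key : PowerSeries.coeff n (cfTrunc c (n + 1) *
      (1 - PowerSeries.C (c 0) * PowerSeries.X * cfTrunc (fun j => c (j + 1)) n)) =
      PowerSeries.coeff n 1 := by
    congr 1
    exact PowerSeries.inv_mul_cancel _ (by simp)
  rw [← key, PowerSeries.coeff_mul, PowerSeries.coeff_mul]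
  refine Finset.sum_congr rfl fun x hx => ?_
  have hx' := Finset.HasAntidiagonal.mem_antidiagonal.1 hx
  rw [coeff_cfTrunc_eq c x.1 (n + 1) (by omega)]
  congr 1
  rw [map_sub, map_sub, mul_assoc, mul_assoc, PowerSeries.coeff_C_mul, PowerSeries.coeff_C_mul]
  congr 2
  rcases hy : x.2 with _ | m
  · simp
  · rw [PowerSeries.coeff_succ_X_mul, PowerSeries.coeff_succ_X_mul,
      coeff_cfTrunc_eq _ m n (by omega)]

theorem cfSeries_eq_one_add {K : Type*} [Field K] (c : ℕ → K) (h : ℕ) :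
    cfSeries (fun j => c (h + j)) = 1 + PowerSeries.C (c h) * PowerSeries.X *
      cfSeries (fun j => c (h + j)) * cfSeries (fun j => c (h + 1 + j)) := by
  have key := cfSeries_mul_eq_one (fun j => c (h + j))
  have e : (fun j => c (h + 1 + j)) = fun j => c (h + (j + 1)) := by
    funext j; congr 1; omega
  rw [e]
  simp only [add_zero] at key
  linear_combination key

/-- Cutting a path from height `h` at its last visits to the heights `h, ..., 1` gives the product;
the proof only checks that both sides satisfy the same recursion. -/
theorem coeff_prod_cfSeries {K : Type*} [Field K] (c : ℕ → K) (n h : ℕ) :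
    PowerSeries.coeff n (PowerSeries.C (∏ i ∈ Finset.range h, c i) *
      ∏ i ∈ Finset.range (h + 1), cfSeries (fun j => c (i + j))) = stieltjesMoment c n h := by
  set N : ℕ → PowerSeries K := fun h => PowerSeries.C (∏ i ∈ Finset.range h, c i) *
      ∏ i ∈ Finset.range (h + 1), cfSeries (fun j => c (i + j)) with hN
  have h0 : N 0 = 1 + PowerSeries.X * N 1 := by
    have := cfSeries_eq_one_add c 0
    simp only [hN, Finset.prod_range_succ, Finset.prod_range_zero, map_one, one_mul]
    linear_combination this
  have h1 : ∀ h, N (h + 1) = PowerSeries.C (c h) * N h + PowerSeries.X * N (h + 2) := by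
    intro h
    have := cfSeries_eq_one_add c (h + 1)
    simp only [hN, Finset.prod_range_succ _ (h + 2), Finset.prod_range_succ _ (h + 1),
      Finset.prod_range_succ c h, map_mul]
    linear_combination (PowerSeries.C (∏ i ∈ Finset.range h, c i) * PowerSeries.C (c h) *
      ∏ i ∈ Finset.range (h + 1), cfSeries (fun j => c (i + j))) * this
  change PowerSeries.coeff n (N h) = _
  clear_value N
  induction n generalizing h with
  | zero => induction h with
    | zero => rw [h0]; simp [stieltjesMoment]
    | succ h ih => rw [h1]; simp [stieltjesMoment, ← ih]
  | succ n ihn => induction h with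
    | zero => rw [h0]; simp [stieltjesMoment, ihn, PowerSeries.coeff_succ_X_mul,
        PowerSeries.coeff_one]
    | succ h ih => rw [h1]; simp [stieltjesMoment, ih, ihn, PowerSeries.coeff_succ_X_mul]

theorem coeff_cfSeries {K : Type*} [Field K] (c : ℕ → K) (n : ℕ) :
    PowerSeries.coeff n (cfSeries c) = stieltjesMoment c n 0 := by
  simpa using coeff_prod_cfSeries c n 0

/-- If `p` is the sequence of orthogonal polynomials in `y` with recurrence coefficients `c`, and
`L` is a linear functional that vanishes on `p n` for `n ≥ 1`, then the moments of `L` are those of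
the continued fraction. -/
theorem apply_pow_mul_eq_stieltjesMoment {F A : Type*} [CommRing F] [CommRing A] [Algebra F A]
    (c : ℕ → F) (y : A) (p : ℕ → A) (hp0 : p 0 = 1) (hp1 : p 1 = y)
    (hp : ∀ n, p (n + 2) = y * p (n + 1) - c n • p n) (L : A →ₗ[F] F) (hL0 : L 1 = 1)
    (hL : ∀ n, L (p (n + 1)) = 0) (n h : ℕ) :
    L (y ^ (h + 2 * n) * p h) = stieltjesMoment c n h := by
  have step : ∀ j h, L (y ^ (j + 1) * p (h + 1)) =
      L (y ^ j * p (h + 2)) + c h * L (y ^ j * p h) := by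
    intro j h
    rw [← smul_eq_mul (c h), ← map_smul, ← map_add, hp, pow_succ]
    congr 1
    simp only [Algebra.smul_def]
    ring
  -- Multiplication by `y` lowers the index by at most one, so index 0 is out of reach.
  have zero : ∀ j h, j < h → L (y ^ j * p h) = 0 := by
    intro j
    induction j with
    | zero =>
      intro h hh
      obtain ⟨h, rfl⟩ := Nat.exists_eq_succ_of_ne_zero hh.ne'
      simpa using hL h
    | succ j ih =>
      intro h hh
      obtain ⟨h, rfl⟩ := Nat.exists_eq_succ_of_ne_zero (by omega : h ≠ 0)
      rw [Nat.succ_eq_add_one, step, ih _ (by omega), ih _ (by omega)]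
      simp
  induction n generalizing h with
  | zero => induction h with
    | zero => simp [stieltjesMoment, hp0, hL0]
    | succ h ih =>
      rw [show h + 1 + 2 * 0 = h + 1 from rfl, step, zero _ _ (by omega), stieltjesMoment, ← ih]
      simp
  | succ n ihn => induction h with
    | zero =>
      rw [stieltjesMoment, ← ihn, hp0, hp1, ← pow_succ, mul_one]
      congr 2
      omega
    | succ h ih =>
      rw [stieltjesMoment, ← ih, ← ihn, show h + 1 + 2 * (n + 1) = (h + 2 * (n + 1)) + 1 by omega,
        step, add_comm, show h + 2 + 2 * n = h + 2 * (n + 1) by omega]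

/-! ### Two families of Al-Salam–Chihara polynomials -/

/-- The monic orthogonal polynomials in `y` with recurrence coefficients `(1 - q ^ n) ^ 2`. -/
def secantPoly {A : Type*} [CommRing A] (q y : A) : ℕ → A
  | 0 => 1
  | 1 => y
  | n + 2 => y * secantPoly q y (n + 1) - (1 - q ^ (n + 1)) ^ 2 * secantPoly q y n

/-- The monic orthogonal polynomials in `y` with recurrence coefficients
`(1 - q ^ n) * (1 - q ^ (n + 2))`. -/
def shiftedSecantPoly {A : Type*} [CommRing A] (q y : A) : ℕ → A
  | 0 => 1
  | 1 => y
  | n + 2 => y * shiftedSecantPoly q y (n + 1) -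
      (1 - q ^ (n + 1)) * (1 - q ^ (n + 3)) * shiftedSecantPoly q y n

theorem secantPoly_eq {A : Type*} [CommRing A] (q y : A) (n : ℕ) :
    secantPoly q y (n + 2) = y * shiftedSecantPoly q y (n + 1) -
      (1 - q ^ (n + 1)) * (1 - q) * shiftedSecantPoly q y n := by
  induction n using Nat.twoStepInduction with
  | zero => simp only [secantPoly, shiftedSecantPoly]; ring
  | one => simp only [secantPoly, shiftedSecantPoly]; ring
  | more n ih1 ih2 =>
    rw [secantPoly, ih1, ih2]
    simp only [shiftedSecantPoly]
    ring

/-- The polynomials obtained from the orthogonal polynomials with recurrence coefficients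
`(1 - q ^ n) * (1 - q ^ (n + 1))` in `t + t⁻¹` by a scaling of `t`; here `u` is `q * t⁻¹`. -/
def scaledPoly {A : Type*} [CommRing A] (q t u : A) : ℕ → A
  | 0 => 1
  | 1 => t + u
  | n + 2 => (t + u) * scaledPoly q t u (n + 1) -
      q * ((1 - q ^ (n + 1)) * (1 - q ^ (n + 2))) * scaledPoly q t u n

theorem map_scaledPoly {A B : Type*} [CommRing A] [CommRing B] (f : A →+* B) (q t u : A) (n : ℕ) :
    f (scaledPoly q t u n) = scaledPoly (f q) (f t) (f u) n := by
  induction n using Nat.twoStepInduction with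
  | zero => simp [scaledPoly]
  | one => simp [scaledPoly]
  | more n ih1 ih2 => simp [scaledPoly, ih1, ih2]

theorem scaledPoly_comm {A : Type*} [CommRing A] (q t u : A) (n : ℕ) :
    scaledPoly q t u n = scaledPoly q u t n := by
  induction n using Nat.twoStepInduction with
  | zero => rfl
  | one => simp [scaledPoly, add_comm]
  | more n ih1 ih2 => simp [scaledPoly, ih1, ih2, add_comm]

theorem scaledPoly_succ_eq {A : Type*} [CommRing A] (q t t' : A) (ht : t * t' = 1) (n : ℕ) :
    scaledPoly q t (q * t') (n + 1) = shiftedSecantPoly q (t + t') (n + 1) -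
      t' * (1 - q ^ (n + 1)) * shiftedSecantPoly q (t + t') n := by
  induction n using Nat.twoStepInduction with
  | zero => simp only [scaledPoly, shiftedSecantPoly]; ring
  | one =>
    simp only [scaledPoly, shiftedSecantPoly]
    linear_combination (2 * q - 1 - q ^ 2) * ht
  | more n ih1 ih2 =>
    rw [scaledPoly, ih2, ih1]
    simp only [shiftedSecantPoly]
    linear_combination ((q - 1 + q ^ (n + 1) * q - q ^ (n + 1) * q ^ 2) *
      shiftedSecantPoly q (t + t') (n + 1)) * ht

/-- The raising operator takes `scaledPoly` to `secantPoly`. -/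
theorem sub_mul_secantPoly {A : Type*} [CommRing A] (q t t' : A) (ht : t * t' = 1) (n : ℕ) :
    (t - t') * secantPoly q (t + t') (n + 1) =
      t * ((t + q * t') * scaledPoly q t (q * t') n) -
        t' * ((t' + q * t) * scaledPoly q t' (q * t) n) := by
  cases n with
  | zero => simp only [secantPoly, scaledPoly]; ring
  -- Both sides are expanded in `shiftedSecantPoly`.
  | succ n =>
    rw [secantPoly_eq, scaledPoly_succ_eq q t t' ht,
      scaledPoly_succ_eq q t' t (by rw [mul_comm]; exact ht), add_comm t' t]
    linear_combination ((1 - q ^ (n + 1)) * (1 - q) * (t - t') *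
      shiftedSecantPoly q (t + t') n) * ht

/-! ### The moment functional -/

/-- The sum `∑ (-1) ^ (i + k) * q ^ (i * (2 * k - i) + k)` over `0 ≤ i ≤ 2 * k`. -/
def thetaSum {R : Type*} [CommRing R] (q : R) (k : ℕ) : R :=
  ∑ i ∈ Finset.range (2 * k + 1), (-1) ^ (i + k) * q ^ (i * (2 * k - i) + k)

theorem thetaSum_zero {R : Type*} [CommRing R] (q : R) : thetaSum q 0 = 1 := by
  simp [thetaSum]

/-- The two extreme terms both equal `(-q) ^ (k + 1)`; for the others, shifting `i` by one adds `2 *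
k + 2` to the exponent. -/
theorem thetaSum_succ {R : Type*} [CommRing R] (q : R) (k : ℕ) :
    thetaSum q (k + 1) = q ^ (2 * (k + 1)) * thetaSum q k + 2 * (-q) ^ (k + 1) := by
  rw [thetaSum, show 2 * (k + 1) + 1 = (2 * k + 1) + 1 + 1 by ring, Finset.sum_range_succ,
    Finset.sum_range_succ', thetaSum, Finset.mul_sum]
  have h : ∀ i ∈ Finset.range (2 * k + 1),
      (-1 : R) ^ (i + 1 + (k + 1)) * q ^ ((i + 1) * (2 * (k + 1) - (i + 1)) + (k + 1)) =
        q ^ (2 * (k + 1)) * ((-1) ^ (i + k) * q ^ (i * (2 * k - i) + k)) := by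
    intro i hi
    obtain ⟨j, hj⟩ := Nat.exists_eq_add_of_le (Nat.lt_succ_iff.1 (Finset.mem_range.1 hi))
    rw [show 2 * (k + 1) - (i + 1) = j + 1 by omega, show 2 * k - i = j by omega,
      show (i + 1) * (j + 1) + (k + 1) = (i * j + k) + 2 * (k + 1) by
        rw [show 2 * (k + 1) = i + j + 2 by omega]; ring,
      show i + 1 + (k + 1) = (i + k) + 2 by ring]
    ring
  rw [Finset.sum_congr rfl h]
  have e : (-1 : R) ^ (2 * k + 1 + 1 + (k + 1)) = (-1) ^ (k + 1) := by
    rw [show 2 * k + 1 + 1 + (k + 1) = 2 * (k + 1) + (k + 1) by ring, pow_add, pow_mul]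
    simp
  rw [e, show 2 * (k + 1) - (2 * k + 1 + 1) = 0 by omega, neg_pow q]
  simp
  ring

theorem map_thetaSum {R S : Type*} [CommRing R] [CommRing S] (f : R →+* S) (q : R) (k : ℕ) :
    f (thetaSum q k) = thetaSum (f q) k := by
  simp [thetaSum]

/-- The extension of `thetaSum` to integer indices with `thetaSum q (-k - 1) = -thetaSum q k`. -/
def intThetaSum {R : Type*} [CommRing R] (q : R) : ℤ → R
  | Int.ofNat k => thetaSum q k
  | Int.negSucc k => -thetaSum q k

theorem intThetaSum_natCast {R : Type*} [CommRing R] (q : R) (k : ℕ) :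
    intThetaSum q (k : ℤ) = thetaSum q k := rfl

theorem intThetaSum_neg_sub_one {R : Type*} [CommRing R] (q : R) (k : ℕ) :
    intThetaSum q (-(k : ℤ) - 1) = -thetaSum q k := by
  rw [show -(k : ℤ) - 1 = Int.negSucc k by omega]
  rfl

/-- The sign extension is chosen so that the recurrence survives at all integers: at 0 it reads `1 +
1 = 2`, and `k ↦ -k` preserves it. -/
theorem intThetaSum_sub {F : Type*} [Field F] {q : F} (hq : q ≠ 0) (k : ℤ) :
    intThetaSum q k - q ^ (2 * k) * intThetaSum q (k - 1) = 2 * (-q) ^ k := by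
  rcases lt_trichotomy k 0 with h | rfl | h
  · obtain ⟨m, rfl⟩ : ∃ m : ℕ, k = -((m + 1 : ℕ) : ℤ) := ⟨(-k - 1).toNat, by omega⟩
    rw [intThetaSum_neg_sub_one, thetaSum_succ,
      show -((m + 1 : ℕ) : ℤ) = -(m : ℤ) - 1 by push_cast; ring, intThetaSum_neg_sub_one,
      show -(m : ℤ) - 1 = -((m + 1 : ℕ) : ℤ) by push_cast; ring, mul_neg (2 : ℤ), zpow_neg, zpow_neg,
      show (2 : ℤ) * ((m + 1 : ℕ) : ℤ) = ((2 * (m + 1) : ℕ) : ℤ) by push_cast; ring,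
      zpow_natCast, zpow_natCast, neg_pow q]
    have h1 : ((-1 : F) ^ (m + 1)) ≠ 0 := by simp
    have h2 : ((-1 : F) ^ (m + 1)) * (-1) ^ (m + 1) = 1 := by
      rw [← mul_pow]; simp
    field_simp
    linear_combination 2 * q ^ (2 * (m + 1)) * h2
  · rw [show (0 : ℤ) - 1 = -((0 : ℕ) : ℤ) - 1 by simp, intThetaSum_neg_sub_one,
      show (0 : ℤ) = ((0 : ℕ) : ℤ) by simp, intThetaSum_natCast, thetaSum_zero]
    norm_num
  · obtain ⟨m, rfl⟩ : ∃ m : ℕ, k = ((m + 1 : ℕ) : ℤ) := ⟨(k - 1).toNat, by omega⟩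
    rw [intThetaSum_natCast, show (((m + 1 : ℕ) : ℤ)) - 1 = (m : ℤ) by push_cast; ring,
      intThetaSum_natCast, thetaSum_succ,
      show (2 : ℤ) * ((m + 1 : ℕ) : ℤ) = ((2 * (m + 1) : ℕ) : ℤ) by push_cast; ring,
      zpow_natCast, zpow_natCast]
    ring

open LaurentPolynomial in
/-- The linear functional on Laurent polynomials with `T j ↦ a j`. -/
noncomputable def laurentFunctional {F : Type*} [Field F] (a : ℤ → F) : F[T;T⁻¹] →ₗ[F] F :=
  Finsupp.linearCombination F a ∘ₗ (AddMonoidAlgebra.coeffLinearEquiv F).toLinearMap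

open LaurentPolynomial in
theorem laurentFunctional_T {F : Type*} [Field F] (a : ℤ → F) (j : ℤ) :
    laurentFunctional a (T j) = a j := by
  change Finsupp.linearCombination F a (Finsupp.single j 1) = a j
  simp

/-- The sequence with value `b k` at `2 * k + 1` and `0` at even indices. -/
def oddSeq {R : Type*} [CommRing R] (b : ℤ → R) (j : ℤ) : R := if Even j then 0 else b (j / 2)

/-- The sequence with value `b k` at `2 * k` and `0` at odd indices. -/
def evenSeq {R : Type*} [CommRing R] (b : ℤ → R) (j : ℤ) : R := if Even j then b (j / 2) else 0

theorem oddSeq_two_mul_add_one {R : Type*} [CommRing R] (b : ℤ → R) (k : ℤ) :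
    oddSeq b (2 * k + 1) = b k := by
  rw [oddSeq, if_neg (by simp)]
  congr 1
  omega

theorem oddSeq_two_mul {R : Type*} [CommRing R] (b : ℤ → R) (k : ℤ) : oddSeq b (2 * k) = 0 := by
  rw [oddSeq, if_pos (by simp)]

theorem evenSeq_two_mul {R : Type*} [CommRing R] (b : ℤ → R) (k : ℤ) :
    evenSeq b (2 * k) = b k := by
  rw [evenSeq, if_pos (by simp)]
  congr 1
  omega

theorem evenSeq_two_mul_add_one {R : Type*} [CommRing R] (b : ℤ → R) (k : ℤ) :
    evenSeq b (2 * k + 1) = 0 := by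
  rw [evenSeq, if_neg (by simp)]

theorem oddSeq_intThetaSum_sub {F : Type*} [Field F] {q : F} (hq : q ≠ 0) (j : ℤ) :
    oddSeq (intThetaSum q) (j + 1) - q ^ j * oddSeq (intThetaSum q) (j - 1) =
      2 * evenSeq (fun k => (-q) ^ k) j := by
  obtain ⟨k, rfl | rfl⟩ := Int.even_or_odd' j
  · rw [oddSeq_two_mul_add_one, show 2 * k - 1 = 2 * (k - 1) + 1 by ring, oddSeq_two_mul_add_one,
      evenSeq_two_mul, intThetaSum_sub hq]
  · rw [show 2 * k + 1 + 1 = 2 * (k + 1) by ring, show 2 * k + 1 - 1 = 2 * k by ring,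
      oddSeq_two_mul, oddSeq_two_mul, evenSeq_two_mul_add_one]
    simp

theorem oddSeq_intThetaSum_neg {R : Type*} [CommRing R] (q : R) (j : ℤ) :
    oddSeq (intThetaSum q) (-j) = -oddSeq (intThetaSum q) j := by
  obtain ⟨k, rfl | rfl⟩ := Int.even_or_odd' j
  · rw [← mul_neg, oddSeq_two_mul, oddSeq_two_mul, neg_zero]
  · rw [show -(2 * k + 1) = 2 * (-k - 1) + 1 by ring, oddSeq_two_mul_add_one,
      oddSeq_two_mul_add_one]
    rcases lt_or_ge k 0 with h | h
    · obtain ⟨m, rfl⟩ : ∃ m : ℕ, k = -(m : ℤ) - 1 := ⟨(-k - 1).toNat, by omega⟩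
      rw [intThetaSum_neg_sub_one, show -(-(m : ℤ) - 1) - 1 = m by ring, intThetaSum_natCast,
        neg_neg]
    · obtain ⟨m, rfl⟩ := Int.eq_ofNat_of_zero_le h
      rw [intThetaSum_neg_sub_one, intThetaSum_natCast]

open LaurentPolynomial in
/-- The substitution `T ↦ q * T` in Laurent polynomials. -/
noncomputable def laurentScale {F : Type*} [Field F] {q : F} (hq : q ≠ 0) :
    F[T;T⁻¹] →+* F[T;T⁻¹] :=
  eval₂ C (Units.map (C (R := F)).toMonoidHom (Units.mk0 q hq) * (isUnit_T 1).unit)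

open LaurentPolynomial in
theorem laurentScale_C {F : Type*} [Field F] {q : F} (hq : q ≠ 0) (a : F) :
    laurentScale hq (C a) = C a := by
  simp [laurentScale]

open LaurentPolynomial in
theorem laurentScale_T {F : Type*} [Field F] {q : F} (hq : q ≠ 0) (j : ℤ) :
    laurentScale hq (T j) = C (q ^ j) * T j := by
  have hT : ((isUnit_T (R := F) 1).unit ^ j).val = T j := by
    cases j with
    | ofNat n => simp [T_pow]
    | negSucc n =>
      rw [zpow_negSucc]
      refine Units.inv_eq_of_mul_eq_one_right ?_
      rw [Units.val_pow_eq_pow_val, IsUnit.unit_spec, T_pow, ← T_add]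
      simp [Int.negSucc_eq]
  rw [laurentScale, eval₂_T, mul_zpow, Units.val_mul, hT, ← map_zpow, Units.coe_map,
    Units.val_zpow_eq_zpow_val]
  rfl

open LaurentPolynomial in
theorem laurentFunctional_scale {F : Type*} [Field F] {q : F} (hq : q ≠ 0) (f : F[T;T⁻¹]) :
    laurentFunctional (oddSeq (intThetaSum q)) (T 1 * f) -
      laurentFunctional (oddSeq (intThetaSum q)) (T (-1) * laurentScale hq f) =
        2 * laurentFunctional (evenSeq (fun k => (-q) ^ k)) f := by
  induction f using LaurentPolynomial.induction_on' with
  | add f g hf hg =>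
    simp only [mul_add, map_add]
    linear_combination hf + hg
  | C_mul_T j a =>
    have h1 : T 1 * (C a * T j) = a • T (1 + j) := by
      rw [smul_eq_C_mul, T_add]; ring
    have h2 : T (-1) * laurentScale hq (C a * T j) = a • q ^ j • T (-1 + j) := by
      rw [map_mul, laurentScale_C, laurentScale_T, smul_eq_C_mul, smul_eq_C_mul, T_add]; ring
    rw [h1, h2, ← smul_eq_C_mul]
    simp only [map_smul, laurentFunctional_T, smul_eq_mul]
    have := oddSeq_intThetaSum_sub hq j
    rw [add_comm 1 j, neg_add_eq_sub]
    linear_combination a * this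

open LaurentPolynomial in
theorem laurentFunctional_invert {F : Type*} [Field F] (q : F) (f : F[T;T⁻¹]) :
    laurentFunctional (oddSeq (intThetaSum q)) (invert f) =
      -laurentFunctional (oddSeq (intThetaSum q)) f := by
  induction f using LaurentPolynomial.induction_on' with
  | add f g hf hg =>
    simp only [map_add, hf, hg]
    ring
  | C_mul_T j a =>
    rw [map_mul, invert_C, invert_T, ← smul_eq_C_mul, ← smul_eq_C_mul]
    simp [laurentFunctional_T, oddSeq_intThetaSum_neg]

-- This functional is the average of the values at the two square roots of `-q`, where `t + q t⁻¹`
-- vanishes.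
open LaurentPolynomial in
theorem laurentFunctional_mul_eq_zero {F : Type*} [Field F] {q : F} (hq : q ≠ 0) (f : F[T;T⁻¹]) :
    laurentFunctional (evenSeq (fun k => (-q) ^ k)) ((T 1 + C q * T (-1)) * f) = 0 := by
  induction f using LaurentPolynomial.induction_on' with
  | add f g hf hg => rw [mul_add, map_add, hf, hg, add_zero]
  | C_mul_T j a =>
    have h1 : (T 1 + C q * T (-1)) * (C a * T j) = a • (T (1 + j) + q • T (-1 + j)) := by
      rw [smul_eq_C_mul, smul_eq_C_mul, T_add, T_add]; ring
    rw [h1]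
    simp only [map_smul, map_add, laurentFunctional_T, smul_eq_mul]
    obtain ⟨k, rfl | rfl⟩ := Int.even_or_odd' j
    · rw [show 1 + 2 * k = 2 * k + 1 by ring, show -1 + 2 * k = 2 * (k - 1) + 1 by ring,
        evenSeq_two_mul_add_one, evenSeq_two_mul_add_one]
      simp
    · rw [show 1 + (2 * k + 1) = 2 * (k + 1) by ring, show -1 + (2 * k + 1) = 2 * k by ring,
        evenSeq_two_mul, evenSeq_two_mul, zpow_add_one₀ (neg_ne_zero.2 hq)]
      ring

theorem map_secantPoly {A B : Type*} [CommRing A] [CommRing B] (f : A →+* B) (q y : A) (n : ℕ) :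
    f (secantPoly q y n) = secantPoly (f q) (f y) n := by
  induction n using Nat.twoStepInduction with
  | zero => simp [secantPoly]
  | one => simp [secantPoly]
  | more n ih1 ih2 => simp [secantPoly, ih1, ih2]

open LaurentPolynomial in
theorem laurentFunctional_secantPoly {F : Type*} [Field F] (h2 : (2 : F) ≠ 0) {q : F} (hq : q ≠ 0)
    (n : ℕ) : laurentFunctional (oddSeq (intThetaSum q))
      (T 1 * secantPoly (C q) (T 1 + T (-1)) (n + 1)) = 0 := by
  set L := laurentFunctional (oddSeq (intThetaSum q))
  have hT : (T 1 * T (-1) : F[T;T⁻¹]) = 1 := by rw [← T_add]; simp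
  set f : F[T;T⁻¹] := (T 1 + C q * T (-1)) * scaledPoly (C q) (T 1) (C q * T (-1)) n with hf
  set p : F[T;T⁻¹] := secantPoly (C q) (T 1 + T (-1)) (n + 1) with hp
  -- Scaling turns the pair `(t, q t⁻¹)` into `(q t, t⁻¹)`, and `scaledPoly` is symmetric in its two
  -- arguments.
  have hscale : laurentScale hq f = (T (-1) + C q * T 1) *
      scaledPoly (C q) (T (-1)) (C q * T 1) n := by
    have e : laurentScale hq (C q * T (-1)) = T (-1) := by
      rw [map_mul, laurentScale_C, laurentScale_T, ← mul_assoc, ← map_mul]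
      simp [hq]
    rw [hf, map_mul, map_add, map_scaledPoly, e, laurentScale_T, laurentScale_C, zpow_one,
      scaledPoly_comm, add_comm]
  have h0 : L (T 1 * f) - L (T (-1) * laurentScale hq f) = 0 := by
    rw [laurentFunctional_scale, hf, laurentFunctional_mul_eq_zero hq, mul_zero]
  have h1 := sub_mul_secantPoly (C q) (T 1) (T (-1)) hT n
  rw [← hscale, ← hf, ← hp] at h1
  rw [← map_sub, ← h1, sub_mul, map_sub] at h0
  have h3 : invert (T 1 * p) = T (-1) * p := by
    rw [map_mul, invert_T, hp]
    congr 1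
    refine (map_secantPoly (invert (R := F)).toRingHom _ _ _).trans ?_
    simp [add_comm]
  rw [← h3, laurentFunctional_invert, sub_neg_eq_add, ← two_mul] at h0
  exact (mul_eq_zero.1 h0).resolve_left h2

/-! ### The closed formula -/

open LaurentPolynomial in
theorem laurentFunctional_pow {F : Type*} [Field F] (q : F) (n : ℕ) :
    laurentFunctional (oddSeq (intThetaSum q)) (T 1 * (T 1 + T (-1)) ^ (2 * n)) =
      ∑ k ∈ Finset.range (n + 1),
        ((binom (2 * n) ((n : ℤ) - k) : F) - (binom (2 * n) ((n : ℤ) - k - 1) : F)) *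
          thetaSum q k := by
  have h1 : (T 1 * (T 1 + T (-1)) ^ (2 * n) : F[T;T⁻¹]) = ∑ m ∈ Finset.range (n + (n + 1)),
      ((2 * n).choose m : F) • T (2 * ((m : ℤ) - n) + 1) := by
    rw [add_pow, Finset.mul_sum, ← add_assoc, ← two_mul]
    refine Finset.sum_congr rfl fun m hm => ?_
    have hm' := Finset.mem_range.1 hm
    rw [T_pow, T_pow, ← T_add, ← mul_assoc, ← T_add, smul_eq_C_mul, map_natCast, mul_comm]
    congr 2
    push_cast [Nat.lt_succ_iff.1 hm']
    ring
  rw [h1, map_sum]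
  simp only [map_smul, laurentFunctional_T, oddSeq_two_mul_add_one, smul_eq_mul]
  -- The indices `m < n` are reflected to `-k - 1` and carry the minus sign; `m = n + k` gives the
  -- plus sign.
  rw [Finset.sum_range_add, ← Finset.sum_range_reflect]
  simp only [sub_mul, Finset.sum_sub_distrib]
  rw [Finset.sum_range_succ (fun k => (binom (2 * n) ((n : ℤ) - k - 1) : F) * thetaSum q k),
    add_comm, sub_eq_add_neg, neg_add]
  have h2 : (binom (2 * n) ((n : ℤ) - n - 1) : F) = 0 := by simp [binom]
  rw [h2, zero_mul, neg_zero, add_zero, ← Finset.sum_neg_distrib]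
  congr 1
  · refine Finset.sum_congr rfl fun k hk => ?_
    have hk' := Nat.lt_succ_iff.1 (Finset.mem_range.1 hk)
    rw [show ((n + k : ℕ) : ℤ) - n = k by push_cast; ring, intThetaSum_natCast, binom,
      if_pos (by omega), show ((n : ℤ) - k).toNat = n - k by omega,
      Nat.choose_symm_of_eq_add (show 2 * n = (n + k) + (n - k) by omega)]
  · refine Finset.sum_congr rfl fun k hk => ?_
    have hk' := Finset.mem_range.1 hk
    rw [show ((n - 1 - k : ℕ) : ℤ) - n = -(k : ℤ) - 1 by omega, intThetaSum_neg_sub_one, binom,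
      if_pos (by omega), show ((n : ℤ) - k - 1).toNat = n - 1 - k by omega, mul_neg]

open LaurentPolynomial in
theorem stieltjesMoment_eq_of_ne_zero {F : Type*} [Field F] (h2 : (2 : F) ≠ 0) {q : F} (hq : q ≠ 0)
    (n : ℕ) : stieltjesMoment (fun j => (1 - q ^ (j + 1)) ^ 2) n 0 =
      ∑ k ∈ Finset.range (n + 1),
        ((binom (2 * n) ((n : ℤ) - k) : F) - (binom (2 * n) ((n : ℤ) - k - 1) : F)) *
          thetaSum q k := by
  have h := apply_pow_mul_eq_stieltjesMoment (fun j => (1 - q ^ (j + 1)) ^ 2)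
    (T 1 + T (-1) : F[T;T⁻¹]) (secantPoly (C q) (T 1 + T (-1))) rfl rfl
    (fun m => by rw [secantPoly, smul_eq_C_mul]; simp)
    (laurentFunctional (oddSeq (intThetaSum q)) ∘ₗ LinearMap.mulLeft F (T 1))
    (by
      rw [LinearMap.comp_apply, LinearMap.mulLeft_apply, mul_one, laurentFunctional_T,
        show (1 : ℤ) = 2 * ((0 : ℕ) : ℤ) + 1 by simp, oddSeq_two_mul_add_one,
        intThetaSum_natCast, thetaSum_zero])
    (fun m => laurentFunctional_secantPoly h2 hq m) n 0
  rw [← h, ← laurentFunctional_pow, secantPoly, mul_one, zero_add, LinearMap.comp_apply,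
    LinearMap.mulLeft_apply]

/-- Both sides are integer polynomials in `q`. Checking them in the fraction field of `ℤ[X]`, where
2 and `X` are nonzero, and specialising covers `q = 0` and characteristic 2. -/
theorem stieltjesMoment_eq {R : Type*} [CommRing R] (q : R) (n : ℕ) :
    stieltjesMoment (fun j => (1 - q ^ (j + 1)) ^ 2) n 0 =
      ∑ k ∈ Finset.range (n + 1),
        ((binom (2 * n) ((n : ℤ) - k) : R) - (binom (2 * n) ((n : ℤ) - k - 1) : R)) *
          thetaSum q k := by
  have generic : stieltjesMoment (fun j => (1 - (Polynomial.X : Polynomial ℤ) ^ (j + 1)) ^ 2) n 0 =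
      ∑ k ∈ Finset.range (n + 1),
        ((binom (2 * n) ((n : ℤ) - k) : Polynomial ℤ) -
          (binom (2 * n) ((n : ℤ) - k - 1) : Polynomial ℤ)) * thetaSum Polynomial.X k := by
    have hinj := IsFractionRing.injective (Polynomial ℤ) (FractionRing (Polynomial ℤ))
    apply hinj
    rw [map_stieltjesMoment, map_sum]
    simp only [map_mul, map_sub, map_pow, map_one, map_natCast, map_thetaSum]
    refine stieltjesMoment_eq_of_ne_zero ?_ ?_ n
    · exact two_ne_zero
    · exact (map_ne_zero_iff _ hinj).2 Polynomial.X_ne_zero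
  have := congrArg (Polynomial.eval₂RingHom (Int.castRingHom R) q) generic
  rw [map_stieltjesMoment, map_sum] at this
  simpa only [map_mul, map_sub, map_pow, map_one, map_natCast, map_thetaSum,
    Polynomial.coe_eval₂RingHom, Polynomial.eval₂_X] using this

/-- A path of length `h + 2 * n` from `h` to 0 has `n + h` down steps. -/
theorem stieltjesMoment_smul {R : Type*} [CommRing R] (a : R) (c : ℕ → R) (n h : ℕ) :
    stieltjesMoment (fun j => a * c j) n h = a ^ (n + h) * stieltjesMoment c n h := by
  induction n generalizing h with
  | zero => induction h with
    | zero => simp [stieltjesMoment]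
    | succ h ih => rw [stieltjesMoment, ih, stieltjesMoment]; ring
  | succ n ihn => induction h with
    | zero => rw [stieltjesMoment, ihn, stieltjesMoment]
    | succ h ih => rw [stieltjesMoment, ih, ihn, stieltjesMoment]; ring

theorem theorem4 {K : Type*} [Field K] (q : K) (hq : q ≠ 1) (n : ℕ) :
    qSecant q n =
      1 / (1 - q) ^ (2 * n) *
        ∑ k ∈ Finset.range (n + 1),
          ((binom (2 * n) ((n : ℤ) - k) : K) - (binom (2 * n) ((n : ℤ) - k - 1) : K)) *
            ∑ i ∈ Finset.range (2 * k + 1), (-1) ^ (i + k) * q ^ (i * (2 * k - i) + k) := by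
  have h : (fun j => qInt q (j + 1) ^ 2) =
      fun j => ((1 - q) ^ 2)⁻¹ * (1 - q ^ (j + 1)) ^ 2 := by
    funext j
    rw [qInt, div_pow, div_eq_inv_mul]
  rw [qSecant, coeff_cfSeries, h, stieltjesMoment_smul, stieltjesMoment_eq, add_zero, inv_pow,
    ← pow_mul, one_div]
  rfl
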